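/- Let $d\ge 2$ be an integer and let $\mu,\lambda,A,\gamma\in\mathbb R$ satisfy $\mu>0$, $\lambda+2\mu>0$, $A>0$ and $\gamma>1$. Let $\rho:\mathbb R^d\to[0,\infty)$ and $v:\mathbb R^d\to\mathbb R^d$ be $C^\infty$ functions that satisfy, on all of $\mathbb R^d$, the stationary barotropic compressible Navier--Stokes equations $$\nabla\cdot(\rho v)=0,\qquad \nabla\cdot(\rho v\otimes v)=-\nabla P+\mu\Delta v+(\mu+\lambda)\nabla(\nabla\cdot v),\qquad P=A\rho^\gamma .$$ If $$\|\rho\|_{L^\infty(\mathbb R^d)}+\|v\|_{L^{d/(d-1)}(\mathbb R^d)}+\|v\|_{L^{3d/(d-1)}(\mathbb R^d)}<\infty,$$ then $v\equiv 0$ and $\rho$ is constant on $\mathbb R^d$. -/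

import Mathlib

open MeasureTheory

open scoped Gradient Laplacian ContDiff

namespace CompressibleNS

/-- The divergence `∑ i, ∂ᵢ wᵢ` of a vector field on `ℝᵈ`. -/
noncomputable def divergence {d : ℕ}
    (w : EuclideanSpace ℝ (Fin d) → EuclideanSpace ℝ (Fin d))
    (x : EuclideanSpace ℝ (Fin d)) : ℝ :=
  ∑ i, fderiv ℝ (fun y => w y i) x (EuclideanSpace.single i 1)

/-- The barotropic pressure `P = A ρ ^ γ`. -/
noncomputable def pressure {d : ℕ} (A γ : ℝ) (ρ : EuclideanSpace ℝ (Fin d) → ℝ)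
    (x : EuclideanSpace ℝ (Fin d)) : ℝ :=
  A * ρ x ^ γ

/-- `(ρ, v)` is a smooth (`C^∞`) stationary solution on `ℝᵈ` of the barotropic compressible
Navier-Stokes equations with viscosities `μ`, `lam` and pressure law `P = A ρ ^ γ`.
The density is nonnegative; vacuum is allowed. -/
structure IsSmoothStationarySolution {d : ℕ} (μ lam A γ : ℝ)
    (ρ : EuclideanSpace ℝ (Fin d) → ℝ)
    (v : EuclideanSpace ℝ (Fin d) → EuclideanSpace ℝ (Fin d)) : Prop where
  smooth_density : ContDiff ℝ ∞ ρ
  smooth_velocity : ContDiff ℝ ∞ v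
  density_nonneg : ∀ x, 0 ≤ ρ x
  /-- Conservation of mass, `∇ · (ρ v) = 0`. -/
  mass : ∀ x, divergence (fun y => ρ y • v y) x = 0
  /-- The `i`-th component of
  `∇ · (ρ v ⊗ v) = - ∇ P + μ Δ v + (μ + lam) ∇ (∇ · v)`. -/
  momentum : ∀ x i,
    divergence (fun y => (ρ y * v y i) • v y) x =
      - (∇ (pressure A γ ρ) x) i + μ * (Δ v x) i + (μ + lam) * (∇ (divergence v) x) i

end CompressibleNS

/-!
Testing the momentum equation with `v` and using conservation of mass gives an energy balance in
divergence form, the work of the pressure being the flux `γ / (γ - 1) P v`. Its dissipation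
`μ |∇v|² + (μ + λ) (∇ · v)²` need not control `|∇v|²` when only `λ + 2μ > 0`, but it can be
changed by a multiple of the null form `∇ · ((v · ∇) v - (∇ · v) v)`, after which it dominates
`c |∇v|²` with `c = min μ (λ + 2μ)`. For bounded `ρ` the flux is at most a multiple of
`|v| + |v|³ + |v| |∇v|`, so a cutoff at scale `R` and absorption of the last term yield
`∫_{|x| < R} |∇v|² ≤ C R⁻¹ ∫_{R ≤ |x| ≤ 2R} (|v| + |v|³)` for `R ≥ 1`. As the annulus has volume
of order `Rᵈ`, Hölder's inequality makes the right-hand side tend to `0` as soon as `v` and `|v|³`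
lie in `L^{d/(d-1)}`. Hence `v` is constant, the same averages force the constant to be `0`, and
then `∇P = 0`.
-/

namespace CompressibleNS

open Filter Metric Module Set Topology

open scoped RealInnerProductSpace

local notation "𝔼" d:max => EuclideanSpace ℝ (Fin d)

section SecondDerivative

variable {E F : Type*} [NormedAddCommGroup E] [NormedSpace ℝ E]
  [NormedAddCommGroup F] [NormedSpace ℝ F] {f : E → F}

lemma contDiff_one_fderiv (hf : ContDiff ℝ 2 f) : ContDiff ℝ 1 (fderiv ℝ f) :=
  hf.fderiv_right (by norm_num)

lemma hasFDerivAt_fderiv (hf : ContDiff ℝ 2 f) (x : E) :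
    HasFDerivAt (fderiv ℝ f) (fderiv ℝ (fderiv ℝ f) x) x :=
  ((contDiff_one_fderiv hf).differentiable one_ne_zero x).hasFDerivAt

lemma hasFDerivAt_fderiv_apply (hf : ContDiff ℝ 2 f) (x k : E) :
    HasFDerivAt (fun y => fderiv ℝ f y k) ((fderiv ℝ (fderiv ℝ f) x).flip k) x := by
  simpa using (hasFDerivAt_fderiv hf x).clm_apply (hasFDerivAt_const k x)

lemma fderiv_fderiv_apply (hf : ContDiff ℝ 2 f) (x h k : E) :
    fderiv ℝ (fun y => fderiv ℝ f y k) x h = fderiv ℝ (fderiv ℝ f) x h k := by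
  simp [(hasFDerivAt_fderiv_apply hf x k).fderiv]

lemma fderiv_fderiv_swap (hf : ContDiff ℝ 2 f) (x h k : E) :
    fderiv ℝ (fderiv ℝ f) x h k = fderiv ℝ (fderiv ℝ f) x k h :=
  hf.contDiffAt.isSymmSndFDerivAt (by simp) h k

end SecondDerivative

section Laplacian

variable {ι E F : Type*} [Fintype ι]
  [NormedAddCommGroup E] [InnerProductSpace ℝ E] [FiniteDimensional ℝ E]

lemma laplacian_eq_sum_fderiv_fderiv [NormedAddCommGroup F] [NormedSpace ℝ F] {f : E → F}
    (b : OrthonormalBasis ι ℝ E) (x : E) :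
    Δ f x = ∑ i, fderiv ℝ (fderiv ℝ f) x (b i) (b i) := by
  simp [InnerProductSpace.laplacian_eq_iteratedFDeriv_orthonormalBasis f b,
    iteratedFDeriv_two_apply]

lemma laplacian_norm_sq [NormedAddCommGroup F] [InnerProductSpace ℝ F] {v : E → F}
    (hv : ContDiff ℝ 2 v) (b : OrthonormalBasis ι ℝ E) (x : E) :
    Δ (fun y => ‖v y‖ ^ 2) x = 2 * (⟪v x, Δ v x⟫ + ∑ i, ‖fderiv ℝ v x (b i)‖ ^ 2) := by
  have hdv := hv.differentiable two_ne_zero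
  have hfirst (h y : E) : fderiv ℝ (fun y => ‖v y‖ ^ 2) y h = 2 * ⟪v y, fderiv ℝ v y h⟫ := by
    simp [(hdv y).hasFDerivAt.norm_sq.fderiv]
  have hsecond (h : E) : fderiv ℝ (fderiv ℝ fun y => ‖v y‖ ^ 2) x h h
      = 2 * (⟪v x, fderiv ℝ (fderiv ℝ v) x h h⟫ + ‖fderiv ℝ v x h‖ ^ 2) := by
    have hdvh : HasFDerivAt (fun y => fderiv ℝ v y h) ((fderiv ℝ (fderiv ℝ v) x).flip h) x :=
      hasFDerivAt_fderiv_apply hv x h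
    rw [← fderiv_fderiv_apply (hv.norm_sq ℝ), funext (hfirst h)]
    rw [(((hdv x).hasFDerivAt.inner ℝ hdvh).const_mul 2).fderiv]
    simp
  simp only [laplacian_eq_sum_fderiv_fderiv b, hsecond, ← Finset.mul_sum, Finset.sum_add_distrib,
    inner_sum]

end Laplacian

section Divergence

variable {d : ℕ} {f : 𝔼 d → ℝ} {v w : 𝔼 d → 𝔼 d} {x : 𝔼 d}

lemma apply_eq_sum_smul_single {F : Type*} [NormedAddCommGroup F] [NormedSpace ℝ F]
    (L : 𝔼 d →L[ℝ] F) (y : 𝔼 d) : L y = ∑ i, y i • L (EuclideanSpace.single i 1) := by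
  conv_lhs => rw [← (EuclideanSpace.basisFun (Fin d) ℝ).sum_repr y]
  simp

lemma hasFDerivAt_apply {H : Type*} [NormedAddCommGroup H] [NormedSpace ℝ H] {g : H → 𝔼 d}
    {g' : H →L[ℝ] 𝔼 d} {y : H} (hg : HasFDerivAt g g' y) (i : Fin d) :
    HasFDerivAt (fun z => g z i) ((EuclideanSpace.proj i).comp g') y :=
  (EuclideanSpace.proj i : 𝔼 d →L[ℝ] ℝ).hasFDerivAt.comp y hg

lemma divergence_eq_sum_fderiv (hw : DifferentiableAt ℝ w x) :
    divergence w x = ∑ i, fderiv ℝ w x (EuclideanSpace.single i 1) i := by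
  refine Finset.sum_congr rfl fun i _ => ?_
  simp [(hasFDerivAt_apply hw.hasFDerivAt i).fderiv]

lemma divergence_add (hv : DifferentiableAt ℝ v x) (hw : DifferentiableAt ℝ w x) :
    divergence (fun y => v y + w y) x = divergence v x + divergence w x := by
  simp [divergence_eq_sum_fderiv, hv, hw, hv.fun_add hw, fderiv_fun_add, Finset.sum_add_distrib]

lemma divergence_sub (hv : DifferentiableAt ℝ v x) (hw : DifferentiableAt ℝ w x) :
    divergence (fun y => v y - w y) x = divergence v x - divergence w x := by
  simp [divergence_eq_sum_fderiv, hv, hw, hv.fun_sub hw, fderiv_fun_sub, Finset.sum_sub_distrib]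

lemma divergence_smul (hf : DifferentiableAt ℝ f x) (hw : DifferentiableAt ℝ w x) :
    divergence (fun y => f y • w y) x = f x * divergence w x + fderiv ℝ f x (w x) := by
  rw [divergence_eq_sum_fderiv (hf.fun_smul hw), divergence_eq_sum_fderiv hw,
    apply_eq_sum_smul_single _ (w x), fderiv_fun_smul hf hw]
  simp [Finset.sum_add_distrib, Finset.mul_sum, mul_comm]

lemma divergence_const_smul (c : ℝ) (hw : DifferentiableAt ℝ w x) :
    divergence (fun y => c • w y) x = c * divergence w x := by
  simp [divergence_smul (differentiableAt_const c) hw]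

lemma divergence_eq_fun_sum_fderiv (hw : Differentiable ℝ w) :
    divergence w = fun x => ∑ i, fderiv ℝ w x (EuclideanSpace.single i 1) i :=
  funext fun x => divergence_eq_sum_fderiv (hw x)

lemma contDiff_divergence {m n : WithTop ℕ∞} (hw : ContDiff ℝ n w) (hmn : m + 1 ≤ n) :
    ContDiff ℝ m (divergence w) :=
  ContDiff.sum fun i _ => ((contDiff_euclidean.1 hw i).fderiv_right hmn).clm_apply contDiff_const

lemma fderiv_divergence (hv : ContDiff ℝ 2 v) (x h : 𝔼 d) :
    fderiv ℝ (divergence v) x h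
      = ∑ i, fderiv ℝ (fderiv ℝ v) x h (EuclideanSpace.single i 1) i := by
  have hterm (i : Fin d) := hasFDerivAt_apply
    (hasFDerivAt_fderiv_apply hv x (EuclideanSpace.single i 1)) i
  rw [divergence_eq_fun_sum_fderiv (hv.differentiable two_ne_zero)]
  refine (DFunLike.congr_fun (HasFDerivAt.fun_sum fun i _ => hterm i).fderiv h).trans ?_
  simp

lemma divergence_fderiv_apply (hv : ContDiff ℝ 2 v) (hw : DifferentiableAt ℝ w x) :
    divergence (fun y => fderiv ℝ v y (w y)) x = fderiv ℝ (divergence v) x (w x)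
      + ∑ i, fderiv ℝ v x (fderiv ℝ w x (EuclideanSpace.single i 1)) i := by
  have h := (hasFDerivAt_fderiv hv x).clm_apply hw.hasFDerivAt
  rw [divergence_eq_sum_fderiv h.differentiableAt, h.fderiv, fderiv_divergence hv]
  simp [Finset.sum_add_distrib, fderiv_fderiv_swap hv x _ (w x), add_comm]

lemma gradient_apply (f : 𝔼 d → ℝ) (x : 𝔼 d) (i : Fin d) :
    ∇ f x i = fderiv ℝ f x (EuclideanSpace.single i 1) := by
  simp [← inner_gradient_left, EuclideanSpace.inner_single_right]

lemma contDiff_gradient (hf : ContDiff ℝ 2 f) : ContDiff ℝ 1 (∇ f) :=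
  (InnerProductSpace.toDual ℝ (𝔼 d)).symm.contDiff.comp (contDiff_one_fderiv hf)

lemma divergence_gradient (hf : ContDiff ℝ 2 f) (x : 𝔼 d) : divergence (∇ f) x = Δ f x := by
  rw [laplacian_eq_sum_fderiv_fderiv (EuclideanSpace.basisFun (Fin d) ℝ)]
  refine Finset.sum_congr rfl fun i _ => ?_
  simp only [gradient_apply]
  simp [fderiv_fderiv_apply hf]

end Divergence

section Coercivity

variable {d : ℕ}

lemma norm_sq_le_sum_norm_sq {ι E F : Type*} [Fintype ι] [NormedAddCommGroup E]
    [InnerProductSpace ℝ E] [NormedAddCommGroup F] [NormedSpace ℝ F] (b : OrthonormalBasis ι ℝ E)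
    (L : E →L[ℝ] F) : ‖L‖ ^ 2 ≤ ∑ i, ‖L (b i)‖ ^ 2 := by
  rw [← Real.le_sqrt (norm_nonneg _) (by positivity)]
  refine L.opNorm_le_bound (Real.sqrt_nonneg _) fun x => ?_
  calc ‖L x‖ = ‖∑ i, b.repr x i • L (b i)‖ := by
        conv_lhs => rw [← b.sum_repr x]
        simp only [map_sum, map_smul]
    _ ≤ ∑ i, ‖L (b i)‖ * ‖b.repr x i‖ :=
        norm_sum_le_of_le _ fun i _ => by rw [norm_smul, mul_comm]
    _ ≤ √(∑ i, ‖L (b i)‖ ^ 2) * √(∑ i, ‖b.repr x i‖ ^ 2) := Real.sum_mul_le_sqrt_mul_sqrt _ _ _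
    _ = √(∑ i, ‖L (b i)‖ ^ 2) * ‖x‖ := by
        rw [← EuclideanSpace.norm_eq, b.repr.norm_map]

lemma sum_apply_apply_le_sum_norm_sq (L : 𝔼 d →L[ℝ] 𝔼 d) :
    ∑ i, L (L (EuclideanSpace.single i 1)) i ≤ ∑ i, ‖L (EuclideanSpace.single i 1)‖ ^ 2 := by
  set a : Fin d → Fin d → ℝ := fun i j => L (EuclideanSpace.single i 1) j with ha
  have htrace (i : Fin d) : L (L (EuclideanSpace.single i 1)) i = ∑ j, a i j * a j i := by
    simp [apply_eq_sum_smul_single L (L (EuclideanSpace.single i 1)), ha]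
  have hswap : ∑ i, ∑ j, a j i ^ 2 = ∑ i, ∑ j, a i j ^ 2 := Finset.sum_comm
  calc ∑ i, L (L (EuclideanSpace.single i 1)) i = ∑ i, ∑ j, a i j * a j i := by simp only [htrace]
    _ ≤ ∑ i, ∑ j, (a i j ^ 2 + a j i ^ 2) / 2 := by
        gcongr with i _ j _
        linarith [two_mul_le_add_sq (a i j) (a j i)]
    _ = ∑ i, ∑ j, a i j ^ 2 := by
        simp only [← Finset.sum_div, Finset.sum_add_distrib, hswap]
        ring
    _ = ∑ i, ‖L (EuclideanSpace.single i 1)‖ ^ 2 := by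
        simp only [EuclideanSpace.real_norm_sq_eq, ha]

lemma abs_divergence_le {w : 𝔼 d → 𝔼 d} {x : 𝔼 d} (hw : DifferentiableAt ℝ w x) :
    |divergence w x| ≤ d * ‖fderiv ℝ w x‖ := by
  have hterm (i : Fin d) : |fderiv ℝ w x (EuclideanSpace.single i 1) i| ≤ ‖fderiv ℝ w x‖ :=
    (PiLp.norm_apply_le _ i).trans <| (fderiv ℝ w x).unit_le_opNorm _ (by simp)
  rw [divergence_eq_sum_fderiv hw]
  calc |∑ i, fderiv ℝ w x (EuclideanSpace.single i 1) i|
      ≤ ∑ _ : Fin d, ‖fderiv ℝ w x‖ :=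
        (Finset.abs_sum_le_sum_abs _ _).trans (Finset.sum_le_sum fun i _ => hterm i)
    _ = d * ‖fderiv ℝ w x‖ := by simp

lemma norm_gradient_norm_sq_le {E F : Type*} [NormedAddCommGroup E] [InnerProductSpace ℝ E]
    [CompleteSpace E] [NormedAddCommGroup F] [InnerProductSpace ℝ F] {v : E → F} {x : E}
    (hv : DifferentiableAt ℝ v x) :
    ‖∇ (fun y => ‖v y‖ ^ 2) x‖ ≤ 2 * (‖v x‖ * ‖fderiv ℝ v x‖) := by
  rw [gradient, LinearIsometryEquiv.norm_map, hv.hasFDerivAt.norm_sq.fderiv]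
  calc ‖2 • (innerSL ℝ (v x)).comp (fderiv ℝ v x)‖
      ≤ 2 * ‖(innerSL ℝ (v x)).comp (fderiv ℝ v x)‖ := norm_nsmul_le
    _ ≤ 2 * (‖v x‖ * ‖fderiv ℝ v x‖) := by
        gcongr
        simpa using ContinuousLinearMap.opNorm_comp_le (innerSL ℝ (v x)) (fderiv ℝ v x)

end Coercivity

section Annulus

variable {E F : Type*} [NormedAddCommGroup E] [NormedAddCommGroup F]

/-- The closed annulus `R ≤ ‖x‖ ≤ 2 R`, which carries the gradient of the cutoff function at
scale `R`. -/
def annulus (E : Type*) [NormedAddCommGroup E] (R : ℝ) : Set E := closedBall 0 (2 * R) \ ball 0 R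

lemma mem_annulus {R : ℝ} {x : E} : x ∈ annulus E R ↔ ‖x‖ ≤ 2 * R ∧ R ≤ ‖x‖ := by
  simp [annulus]

lemma isCompact_annulus [ProperSpace E] (R : ℝ) : IsCompact (annulus E R) :=
  (isCompact_closedBall _ _).diff isOpen_ball

variable [MeasurableSpace E] [BorelSpace E]

lemma measurableSet_annulus (R : ℝ) : MeasurableSet (annulus E R) :=
  measurableSet_closedBall.diff measurableSet_ball

lemma tendsto_setIntegral_annulus [NormedSpace ℝ F] {μ : Measure E} {g : E → F}
    (hg : Integrable g μ) :
    Tendsto (fun R => ∫ x in annulus E R, g x ∂μ) atTop (𝓝 0) := by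
  simp_rw [← integral_indicator (measurableSet_annulus _)]
  rw [← integral_zero E F (μ := μ)]
  refine tendsto_integral_filter_of_dominated_convergence (fun x => ‖g x‖) ?_ ?_ hg.norm ?_
  · exact .of_forall fun R => hg.aestronglyMeasurable.indicator (measurableSet_annulus R)
  · exact .of_forall fun R => .of_forall fun x => norm_indicator_le_norm_self g x
  · refine .of_forall fun x => tendsto_const_nhds.congr' ?_
    filter_upwards [eventually_gt_atTop ‖x‖] with R hR
    rw [indicator_of_notMem fun hx => hR.not_ge (mem_annulus.1 hx).2]

variable [NormedSpace ℝ E] [FiniteDimensional ℝ E] {μ : Measure E} [μ.IsAddHaarMeasure]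

lemma measureReal_annulus {R : ℝ} (hR : 0 < R) :
    μ.real (annulus E R) = R ^ finrank ℝ E * ((2 ^ finrank ℝ E - 1) * μ.real (ball 0 1)) := by
  have hsub : ball (0 : E) R ⊆ closedBall 0 (2 * R) :=
    ball_subset_closedBall.trans (closedBall_subset_closedBall (by linarith))
  have hball : μ.real (ball (0 : E) R) = R ^ finrank ℝ E * μ.real (ball 0 1) := by
    simp [measureReal_def, Measure.addHaar_ball_of_pos μ 0 hR, hR.le]
  rw [annulus, measureReal_sdiff hsub measurableSet_ball measure_closedBall_lt_top.ne,
    Measure.addHaar_real_closedBall _ _ (by positivity), hball]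
  ring

lemma inv_mul_setIntegral_annulus_le {p : ℝ} {g : E → F} (hp : (finrank ℝ E : ℝ).HolderConjugate p)
    (hg : MemLp g (ENNReal.ofReal p) μ) {R : ℝ} (hR : 0 < R) :
    R⁻¹ * ∫ x in annulus E R, ‖g x‖ ∂μ
      ≤ ((2 ^ finrank ℝ E - 1) * μ.real (ball 0 1)) ^ (1 / (finrank ℝ E : ℝ))
        * (∫ x in annulus E R, ‖g x‖ ^ p ∂μ) ^ (1 / p) := by
  set W := (2 ^ finrank ℝ E - 1) * μ.real (ball (0 : E) 1)
  have : IsFiniteMeasure (μ.restrict (annulus E R)) :=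
    ⟨by simpa using (isCompact_annulus R).measure_lt_top⟩
  have hholder := integral_mul_le_Lp_mul_Lq_of_nonneg hp (μ := μ.restrict (annulus E R))
    (f := 1) (g := fun x => ‖g x‖) (.of_forall fun _ => zero_le_one)
    (.of_forall fun _ => norm_nonneg _) (memLp_const 1) (hg.norm.restrict _)
  have hvol : μ.real (annulus E R) ^ (1 / (finrank ℝ E : ℝ)) = R * W ^ (1 / (finrank ℝ E : ℝ)) := by
    rw [measureReal_annulus hR, Real.mul_rpow (by positivity) ?_, one_div,
      Real.pow_rpow_inv_natCast hR.le (by exact_mod_cast hp.ne_zero)]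
    exact mul_nonneg (sub_nonneg.2 (one_le_pow₀ one_le_two)) measureReal_nonneg
  calc R⁻¹ * ∫ x in annulus E R, ‖g x‖ ∂μ
      ≤ R⁻¹ * (μ.real (annulus E R) ^ (1 / (finrank ℝ E : ℝ))
          * (∫ x in annulus E R, ‖g x‖ ^ p ∂μ) ^ (1 / p)) := by
        gcongr
        simpa using hholder
    _ = W ^ (1 / (finrank ℝ E : ℝ)) * (∫ x in annulus E R, ‖g x‖ ^ p ∂μ) ^ (1 / p) := by
        rw [hvol]
        field_simp

lemma tendsto_annulus_average {p : ℝ} {g : E → F} (hp : (finrank ℝ E : ℝ).HolderConjugate p)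
    (hg : MemLp g (ENNReal.ofReal p) μ) :
    Tendsto (fun R => R⁻¹ * ∫ x in annulus E R, ‖g x‖ ∂μ) atTop (𝓝 0) := by
  have hpos : 0 < p := hp.symm.pos
  have hint : Integrable (fun x => ‖g x‖ ^ p) μ := by
    simpa [hpos.le] using hg.integrable_norm_rpow (by simpa using hpos) ENNReal.ofReal_ne_top
  have hbound := ((tendsto_setIntegral_annulus hint).rpow_const (p := 1 / p)
    (.inr (by positivity))).const_mul
      (((2 ^ finrank ℝ E - 1) * μ.real (ball (0 : E) 1)) ^ (1 / (finrank ℝ E : ℝ)))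
  rw [Real.zero_rpow (by positivity), mul_zero] at hbound
  refine squeeze_zero' ?_ ?_ hbound
  · filter_upwards [eventually_ge_atTop 0] with R hR
    exact mul_nonneg (inv_nonneg.2 hR) (integral_nonneg fun _ => norm_nonneg _)
  · filter_upwards [eventually_gt_atTop 0] with R hR
    exact inv_mul_setIntegral_annulus_le hp hg hR

lemma tendsto_annulus_average_norm_add_norm_cube {p : ℝ} {g : E → F}
    (hp : (finrank ℝ E : ℝ).HolderConjugate p) (hg : MemLp g (ENNReal.ofReal p) μ)
    (hg3 : MemLp g (3 * ENNReal.ofReal p) μ) :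
    Tendsto (fun R => R⁻¹ * ∫ x in annulus E R, (‖g x‖ + ‖g x‖ ^ 3) ∂μ) atTop (𝓝 0) := by
  have hcube : MemLp (fun x => ‖g x‖ ^ 3) (ENNReal.ofReal p) μ := by
    have hdiv : 3 * ENNReal.ofReal p / 3 = ENNReal.ofReal p := by
      rw [ENNReal.mul_div_right_comm, ENNReal.div_self three_ne_zero ENNReal.ofNat_ne_top, one_mul]
    simpa [hdiv] using hg3.norm_rpow_div 3
  have hnonneg (x : E) : 0 ≤ ‖g x‖ + ‖g x‖ ^ 3 := by positivity
  simpa only [Pi.add_apply, Real.norm_of_nonneg (hnonneg _)] using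
    tendsto_annulus_average hp (hg.norm.add hcube)

lemma eq_zero_of_tendsto_annulus_average [Nontrivial E] {a : ℝ}
    (h : Tendsto (fun R => R⁻¹ * ∫ _ in annulus E R, a ∂μ) atTop (𝓝 0)) : a = 0 := by
  set W := (2 ^ finrank ℝ E - 1) * μ.real (ball (0 : E) 1)
  have hdim : finrank ℝ E ≠ 0 := finrank_pos.ne'
  have hW : 0 < W := mul_pos (sub_pos.2 (one_lt_pow₀ one_lt_two hdim))
    (ENNReal.toReal_pos (measure_ball_pos μ 0 one_pos).ne' measure_ball_lt_top.ne)
  suffices hle : W * |a| ≤ 0 from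
    abs_nonpos_iff.1 (nonpos_of_mul_nonpos_right hle hW)
  refine ge_of_tendsto (abs_zero (α := ℝ) ▸ h.abs) ?_
  filter_upwards [eventually_ge_atTop 1] with R hR
  have hR0 : 0 < R := by linarith
  calc W * |a| = R⁻¹ * (R * W * |a|) := by field_simp
    _ ≤ R⁻¹ * (R ^ finrank ℝ E * W * |a|) := by
        gcongr
        exact le_self_pow₀ hR hdim
    _ = |R⁻¹ * ∫ _ in annulus E R, a ∂μ| := by
        rw [setIntegral_const, measureReal_annulus hR0, smul_eq_mul, abs_mul, abs_mul, abs_mul,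
          abs_of_pos hW, abs_of_pos (inv_pos.2 hR0), abs_of_pos (pow_pos hR0 _)]

end Annulus

section Cutoff

lemma norm_inv_smul_of_pos {E : Type*} [SeminormedAddCommGroup E] [NormedSpace ℝ E] {R : ℝ}
    (hR : 0 < R) (x : E) : ‖R⁻¹ • x‖ = ‖x‖ / R := by
  rw [norm_smul_of_nonneg (inv_nonneg.2 hR.le), inv_mul_eq_div]

variable {E : Type*} [NormedAddCommGroup E] [NormedSpace ℝ E] [HasContDiffBump E]

/-- The smooth cutoff function at scale `R > 0`: a fixed bump function with plateau `‖x‖ ≤ 1` and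
support `‖x‖ ≤ 2`, dilated by the factor `R`. -/
noncomputable def cutoff (R : ℝ) (x : E) : ℝ :=
  (⟨1, 2, one_pos, one_lt_two⟩ : ContDiffBump (0 : E)) (R⁻¹ • x)

variable {R : ℝ} {x : E}

lemma contDiff_cutoff : ContDiff ℝ ∞ (cutoff R : E → ℝ) :=
  ContDiffBump.contDiff _ |>.comp (contDiff_const_smul R⁻¹)

lemma differentiable_cutoff : Differentiable ℝ (cutoff R : E → ℝ) :=
  contDiff_cutoff.differentiable (by simp)

lemma cutoff_nonneg : 0 ≤ cutoff R x := ContDiffBump.nonneg _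

lemma cutoff_le_one : cutoff R x ≤ 1 := ContDiffBump.le_one _

lemma cutoff_eq_one (hR : 0 < R) (hx : ‖x‖ ≤ R) : cutoff R x = 1 :=
  ContDiffBump.one_of_mem_closedBall _ <| by
    rw [mem_closedBall_zero_iff, norm_inv_smul_of_pos hR]
    exact (div_le_one hR).2 hx

lemma cutoff_eq_zero (hR : 0 < R) (hx : 2 * R ≤ ‖x‖) : cutoff R x = 0 :=
  ContDiffBump.zero_of_le_dist _ <| by
    rw [dist_zero_right, norm_inv_smul_of_pos hR]
    exact (le_div_iff₀ hR).2 hx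

lemma hasCompactSupport_cutoff [ProperSpace E] (hR : 0 < R) :
    HasCompactSupport (cutoff R : E → ℝ) :=
  .intro (isCompact_closedBall 0 (2 * R)) fun _ hx =>
    cutoff_eq_zero hR (by simpa using (mt mem_closedBall_zero_iff.2 hx |> not_le.1).le)

lemma fderiv_cutoff_of_notMem_annulus (hR : 0 < R) (hx : x ∉ annulus E R) :
    fderiv ℝ (cutoff R) x = 0 := by
  rw [mem_annulus, not_and_or, not_le, not_le] at hx
  rcases hx with hfar | hnear
  · refine IsLocalMin.fderiv_eq_zero (.of_forall fun y => ?_)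
    exact (cutoff_eq_zero hR hfar.le).trans_le cutoff_nonneg
  · refine IsLocalMax.fderiv_eq_zero (.of_forall fun y => ?_)
    exact cutoff_le_one.trans_eq (cutoff_eq_one hR hnear.le).symm

lemma hasCompactSupport_cutoff_sq [ProperSpace E] (hR : 0 < R) :
    HasCompactSupport fun x : E => cutoff R x ^ 2 :=
  (hasCompactSupport_cutoff hR).comp_left (g := (· ^ 2)) (zero_pow two_ne_zero)

lemma integrable_cutoff_sq_mul [ProperSpace E] [MeasurableSpace E] [BorelSpace E] {μ : Measure E}
    [IsFiniteMeasureOnCompacts μ] {f : E → ℝ} (hR : 0 < R) (hf : Continuous f) :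
    Integrable (fun x => cutoff R x ^ 2 * f x) μ :=
  ((contDiff_cutoff.continuous.pow 2).mul hf).integrable_of_hasCompactSupport
    (hasCompactSupport_cutoff_sq hR).mul_right

variable (E) in
lemma exists_norm_fderiv_cutoff_le [FiniteDimensional ℝ E] :
    ∃ L, 0 ≤ L ∧ ∀ R > 0, ∀ x : E, ‖fderiv ℝ (cutoff R) x‖ ≤ L * R⁻¹ := by
  set b : ContDiffBump (0 : E) := ⟨1, 2, one_pos, one_lt_two⟩
  have hbdiff : ContDiff ℝ 1 b := b.contDiff
  obtain ⟨L, hL⟩ := (hbdiff.continuous_fderiv one_ne_zero).bounded_above_of_compact_support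
    (b.hasCompactSupport.fderiv ℝ)
  refine ⟨L, (norm_nonneg _).trans (hL 0), fun R hR x => ?_⟩
  have hscale : fderiv ℝ (cutoff R) x = R⁻¹ • fderiv ℝ b (R⁻¹ • x) := fderiv_comp_smul ..
  rw [hscale, norm_smul, Real.norm_of_nonneg (inv_nonneg.2 hR.le), mul_comm]
  gcongr
  exact hL _

end Cutoff

section Liouville

variable {d : ℕ}

lemma integral_mul_divergence {φ : 𝔼 d → ℝ} {K : 𝔼 d → 𝔼 d} (hφ : ContDiff ℝ 1 φ)
    (hcompact : HasCompactSupport φ) (hK : ContDiff ℝ 1 K) :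
    ∫ x, φ x * divergence K x = -∫ x, fderiv ℝ φ x (K x) := by
  have hKi := contDiff_euclidean.1 hK
  have hdφ (i : Fin d) : Continuous fun x => fderiv ℝ φ x (EuclideanSpace.single i 1) :=
    (hφ.continuous_fderiv one_ne_zero).clm_apply continuous_const
  have hdK (i : Fin d) :
      Continuous fun x => fderiv ℝ (fun y => K y i) x (EuclideanSpace.single i 1) :=
    ((hKi i).continuous_fderiv one_ne_zero).clm_apply continuous_const
  have hleft (i : Fin d) : Integrable fun x =>
      φ x * fderiv ℝ (fun y => K y i) x (EuclideanSpace.single i 1) :=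
    (hφ.continuous.mul (hdK i)).integrable_of_hasCompactSupport hcompact.mul_right
  have hright (i : Fin d) : Integrable fun x =>
      fderiv ℝ φ x (EuclideanSpace.single i 1) * K x i :=
    ((hdφ i).mul (hKi i).continuous).integrable_of_hasCompactSupport
      (hcompact.fderiv_apply ℝ _).mul_right
  have hexpand (x : 𝔼 d) :
      fderiv ℝ φ x (K x) = ∑ i, fderiv ℝ φ x (EuclideanSpace.single i 1) * K x i := by
    simp [apply_eq_sum_smul_single _ (K x), mul_comm]
  simp only [divergence, Finset.mul_sum, hexpand]
  rw [integral_finsetSum _ fun i _ => hleft i, integral_finsetSum _ fun i _ => hright i,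
    ← Finset.sum_neg_distrib]
  refine Finset.sum_congr rfl fun i _ => ?_
  exact integral_mul_fderiv_eq_neg_fderiv_mul_of_integrable (hright i) (hleft i)
    ((hφ.continuous.mul (hKi i).continuous).integrable_of_hasCompactSupport hcompact.mul_right)
    (fun x _ => hφ.differentiable one_ne_zero x) fun x _ => (hKi i).differentiable one_ne_zero x

lemma mul_add_mul_le_of_sq_le {a c g r s t N : ℝ} (ha : 0 ≤ a) (hc : 0 < c) (hr : r ∈ Icc 0 1)
    (ht : t ∈ Icc 0 1) (hN : N ^ 2 ≤ g) :
    t * (a * r) * (g + N * s) ≤ c / 2 * (t ^ 2 * s ^ 2) + (a + a ^ 2 / (2 * c)) * (r * g) := by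
  have hg : 0 ≤ g := (sq_nonneg N).trans hN
  have hlinear : t * (a * r * g) ≤ a * r * g :=
    mul_le_of_le_one_left (mul_nonneg (mul_nonneg ha hr.1) hg) ht.2
  have hyoung : a * r * N * (t * s) ≤ c / 2 * (t * s) ^ 2 + (a * r * N) ^ 2 / (2 * c) := by
    have hsquare : 0 ≤ (c * (t * s) - a * r * N) ^ 2 / (2 * c) := by positivity
    have hexpand : (c * (t * s) - a * r * N) ^ 2 / (2 * c)
        = c / 2 * (t * s) ^ 2 + (a * r * N) ^ 2 / (2 * c) - a * r * N * (t * s) := by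
      field_simp
      ring
    linarith
  have hquadratic : (a * r * N) ^ 2 / (2 * c) ≤ a ^ 2 / (2 * c) * (r * g) := by
    have hrN : r ^ 2 * N ^ 2 ≤ r * g :=
      mul_le_mul (by nlinarith [hr.1, hr.2]) hN (sq_nonneg N) hr.1
    calc (a * r * N) ^ 2 / (2 * c) = a ^ 2 / (2 * c) * (r ^ 2 * N ^ 2) := by ring
      _ ≤ a ^ 2 / (2 * c) * (r * g) := by gcongr
  linarith

variable {s g N : 𝔼 d → ℝ} {K : 𝔼 d → 𝔼 d} {c C : ℝ}

lemma exists_fderiv_cutoff_sq_apply_le (hc : 0 < c) (hC : 0 ≤ C)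
    (hN : ∀ x, N x ^ 2 ≤ g x) (hKle : ∀ x, ‖K x‖ ≤ C * (g x + N x * s x)) :
    ∃ C', ∀ R ≥ 1, ∀ x, fderiv ℝ (fun y => cutoff R y ^ 2) x (K x)
      ≤ c / 2 * (cutoff R x ^ 2 * s x ^ 2) + C' * (R⁻¹ * (annulus (𝔼 d) R).indicator g x) := by
  obtain ⟨L, hL, hcutoff⟩ := exists_norm_fderiv_cutoff_le (𝔼 d)
  set a := 2 * L * C
  have ha : 0 ≤ a := by positivity
  refine ⟨a + a ^ 2 / (2 * c), fun R hR x => ?_⟩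
  have hR0 : 0 < R := by linarith
  have hsq : fderiv ℝ (fun y => cutoff R y ^ 2) x (K x)
      = 2 * cutoff R x * fderiv ℝ (cutoff R) x (K x) := by
    rw [fderiv_fun_pow 2 (differentiable_cutoff x)]
    simp
  rw [hsq]
  by_cases hx : x ∈ annulus (𝔼 d) R
  · rw [indicator_of_mem hx]
    refine le_trans ?_ (mul_add_mul_le_of_sq_le ha hc ⟨by positivity, inv_le_one_of_one_le₀ hR⟩
      ⟨cutoff_nonneg, cutoff_le_one⟩ (hN x))
    calc 2 * cutoff R x * fderiv ℝ (cutoff R) x (K x)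
        ≤ 2 * cutoff R x * ((L * R⁻¹) * (C * (g x + N x * s x))) := by
          have : 0 ≤ cutoff R x := cutoff_nonneg
          gcongr
          exact (le_abs_self _).trans
            ((fderiv ℝ (cutoff R) x).le_of_opNorm_le_of_le (hcutoff R hR0 x) (hKle x))
      _ = cutoff R x * (a * R⁻¹) * (g x + N x * s x) := by ring
  · rw [indicator_of_notMem hx, fderiv_cutoff_of_notMem_annulus hR0 hx]
    simp only [zero_apply, mul_zero, add_zero]
    positivity

lemma contDiff_cutoff_sq {R : ℝ} : ContDiff ℝ 1 fun x : 𝔼 d => cutoff R x ^ 2 :=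
  (contDiff_cutoff.of_le (by simp)).pow 2

lemma integrable_fderiv_cutoff_sq_apply {R : ℝ} (hR : 0 < R) (hK : Continuous K) :
    Integrable fun x => fderiv ℝ (fun y => cutoff R y ^ 2) x (K x) :=
  ((contDiff_cutoff_sq.continuous_fderiv one_ne_zero).clm_apply
    hK).integrable_of_hasCompactSupport <|
      ((hasCompactSupport_cutoff_sq hR).fderiv ℝ).mono fun _ hx hx0 => hx (by simp [hx0])

lemma mul_integral_cutoff_sq_mul_sq_le {R : ℝ} (hR : 0 < R) (hK : ContDiff ℝ 1 K)
    (hs : Continuous s) (hdiv : ∀ x, c * s x ^ 2 ≤ -divergence K x) :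
    c * ∫ x, cutoff R x ^ 2 * s x ^ 2 ≤ ∫ x, fderiv ℝ (fun y => cutoff R y ^ 2) x (K x) := by
  have hdivK : Continuous (divergence K) := (contDiff_divergence hK (zero_add _).le).continuous
  rw [← neg_neg (∫ x, fderiv ℝ _ x (K x)), ← integral_mul_divergence contDiff_cutoff_sq
    (hasCompactSupport_cutoff_sq hR) hK, ← integral_neg, ← integral_const_mul]
  refine integral_mono ((integrable_cutoff_sq_mul hR (hs.pow 2)).const_mul c)
    (integrable_cutoff_sq_mul hR hdivK).neg fun x => ?_
  linarith [mul_le_mul_of_nonneg_left (hdiv x) (sq_nonneg (cutoff R x))]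

lemma exists_integral_cutoff_sq_mul_sq_le (hc : 0 < c) (hC : 0 ≤ C) (hK : ContDiff ℝ 1 K)
    (hs : Continuous s) (hg : LocallyIntegrable g) (hN : ∀ x, N x ^ 2 ≤ g x)
    (hKle : ∀ x, ‖K x‖ ≤ C * (g x + N x * s x)) (hdiv : ∀ x, c * s x ^ 2 ≤ -divergence K x) :
    ∃ C', ∀ R ≥ 1, ∫ x, cutoff R x ^ 2 * s x ^ 2
      ≤ C' * (R⁻¹ * ∫ x in annulus (𝔼 d) R, g x) := by
  obtain ⟨C', hpointwise⟩ := exists_fderiv_cutoff_sq_apply_le hc hC hN hKle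
  refine ⟨2 / c * C', fun R hR => ?_⟩
  have hR0 : 0 < R := by linarith
  have hints : Integrable fun x => c / 2 * (cutoff R x ^ 2 * s x ^ 2) :=
    (integrable_cutoff_sq_mul hR0 (hs.pow 2)).const_mul _
  have hintg : Integrable fun x => C' * (R⁻¹ * (annulus (𝔼 d) R).indicator g x) :=
    (((hg.integrableOn_isCompact (isCompact_annulus R)).integrable_indicator
      (measurableSet_annulus R)).const_mul _).const_mul _
  have habsorb : c * ∫ x, cutoff R x ^ 2 * s x ^ 2
      ≤ c / 2 * (∫ x, cutoff R x ^ 2 * s x ^ 2) + C' * (R⁻¹ * ∫ x in annulus (𝔼 d) R, g x) :=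
    calc c * ∫ x, cutoff R x ^ 2 * s x ^ 2
        ≤ ∫ x, fderiv ℝ (fun y => cutoff R y ^ 2) x (K x) :=
          mul_integral_cutoff_sq_mul_sq_le hR0 hK hs hdiv
      _ ≤ ∫ x, (c / 2 * (cutoff R x ^ 2 * s x ^ 2)
            + C' * (R⁻¹ * (annulus (𝔼 d) R).indicator g x)) :=
          integral_mono (integrable_fderiv_cutoff_sq_apply hR0 hK.continuous)
            (hints.add hintg) (hpointwise R hR)
      _ = c / 2 * (∫ x, cutoff R x ^ 2 * s x ^ 2)
            + C' * (R⁻¹ * ∫ x in annulus (𝔼 d) R, g x) := by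
          rw [integral_add hints hintg, integral_const_mul, integral_const_mul,
            integral_const_mul, integral_indicator (measurableSet_annulus R)]
  rw [mul_assoc, div_mul_eq_mul_div, le_div_iff₀ hc]
  linarith

lemma eq_zero_of_le_neg_divergence (hc : 0 < c) (hC : 0 ≤ C) (hK : ContDiff ℝ 1 K)
    (hs : Continuous s) (hg : LocallyIntegrable g) (hN : ∀ x, N x ^ 2 ≤ g x)
    (hKle : ∀ x, ‖K x‖ ≤ C * (g x + N x * s x)) (hdiv : ∀ x, c * s x ^ 2 ≤ -divergence K x)
    (hdecay : Tendsto (fun R => R⁻¹ * ∫ x in annulus (𝔼 d) R, g x) atTop (𝓝 0)) (x : 𝔼 d) :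
    s x = 0 := by
  obtain ⟨C', hcaccioppoli⟩ := exists_integral_cutoff_sq_mul_sq_le hc hC hK hs hg hN hKle hdiv
  have hnonneg (y : 𝔼 d) : 0 ≤ s y ^ 2 := sq_nonneg _
  have hint (r : ℝ) : IntegrableOn (fun y => s y ^ 2) (ball 0 r) :=
    ((hs.pow 2).locallyIntegrable.integrableOn_isCompact (isCompact_closedBall 0 r)).mono_set
      ball_subset_closedBall
  have hball (r : ℝ) : ∫ y in ball 0 r, s y ^ 2 = 0 := by
    refine le_antisymm (ge_of_tendsto (mul_zero C' ▸ hdecay.const_mul C') ?_)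
      (integral_nonneg hnonneg)
    filter_upwards [eventually_ge_atTop r, eventually_ge_atTop 1] with R hrR hR
    have hR0 : 0 < R := by linarith
    calc ∫ y in ball 0 r, s y ^ 2 = ∫ y in ball 0 r, cutoff R y ^ 2 * s y ^ 2 := by
          refine setIntegral_congr_fun measurableSet_ball fun y hy => ?_
          rw [cutoff_eq_one hR0 ((mem_ball_zero_iff.1 hy).le.trans hrR), one_pow, one_mul]
      _ ≤ ∫ y, cutoff R y ^ 2 * s y ^ 2 :=
          setIntegral_le_integral (integrable_cutoff_sq_mul hR0 (hs.pow 2))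
            (.of_forall fun y => by positivity)
      _ ≤ C' * (R⁻¹ * ∫ y in annulus (𝔼 d) R, g y) := hcaccioppoli R hR
  have hae := (setIntegral_eq_zero_iff_of_nonneg_ae (.of_forall hnonneg) (hint _)).1
    (hball (‖x‖ + 1))
  have hzero := Measure.eqOn_open_of_ae_eq hae isOpen_ball (hs.pow 2).continuousOn
    continuousOn_const (mem_ball_zero_iff.2 (lt_add_one ‖x‖))
  exact pow_eq_zero_iff two_ne_zero |>.1 hzero

end Liouville

section Solutions

variable {d : ℕ} {μ lam A γ : ℝ} {ρ : 𝔼 d → ℝ} {v : 𝔼 d → 𝔼 d} {x : 𝔼 d}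

/-- The stationary equations of `IsSmoothStationarySolution`, for a density of class `C¹` and a
velocity of class `C²`, the least regularity at which every term is classically defined. -/
structure IsClassicalStationarySolution (μ lam A γ : ℝ) (ρ : 𝔼 d → ℝ) (v : 𝔼 d → 𝔼 d) :
    Prop where
  contDiff_density : ContDiff ℝ 1 ρ
  contDiff_velocity : ContDiff ℝ 2 v
  density_nonneg : ∀ x, 0 ≤ ρ x
  mass : ∀ x, divergence (fun y => ρ y • v y) x = 0
  momentum : ∀ x i, divergence (fun y => (ρ y * v y i) • v y) x =
    -(∇ (pressure A γ ρ) x) i + μ * (Δ v x) i + (μ + lam) * (∇ (divergence v) x) i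

lemma IsSmoothStationarySolution.isClassicalStationarySolution
    (h : IsSmoothStationarySolution μ lam A γ ρ v) :
    IsClassicalStationarySolution μ lam A γ ρ v where
  contDiff_density := h.smooth_density.of_le (by simp)
  contDiff_velocity := h.smooth_velocity.of_le (by norm_cast)
  density_nonneg := h.density_nonneg
  mass := h.mass
  momentum := h.momentum

lemma contDiff_pressure (hγ : 1 ≤ γ) (hρ : ContDiff ℝ 1 ρ) : ContDiff ℝ 1 (pressure A γ ρ) :=
  contDiff_const.mul (hρ.rpow_const_of_le (m := 1) (by exact_mod_cast hγ))

lemma fderiv_pressure_apply_of_mass (hγ : 1 ≤ γ) (hρ : DifferentiableAt ℝ ρ x)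
    (hv : DifferentiableAt ℝ v x) (hρ0 : 0 ≤ ρ x)
    (hmass : divergence (fun y => ρ y • v y) x = 0) :
    fderiv ℝ (pressure A γ ρ) x (v x) = -(γ * pressure A γ ρ x * divergence v x) := by
  have hfderiv : fderiv ℝ (pressure A γ ρ) x (v x)
      = A * (γ * ρ x ^ (γ - 1)) * fderiv ℝ ρ x (v x) := by
    have hP : HasFDerivAt (pressure A γ ρ) _ x :=
      (hρ.hasFDerivAt.rpow_const (.inr hγ)).const_mul A
    simp [hP.fderiv, mul_assoc]
  have hpow : ρ x ^ (γ - 1) * ρ x = ρ x ^ γ := by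
    rw [← Real.rpow_add_one' hρ0 (by linarith), sub_add_cancel]
  rw [divergence_smul hρ hv] at hmass
  rw [hfderiv, pressure, ← hpow]
  linear_combination A * γ * ρ x ^ (γ - 1) * hmass

lemma divergence_pressure_smul_of_mass (hγ : 1 < γ) (hρ : ContDiff ℝ 1 ρ)
    (hv : DifferentiableAt ℝ v x) (hρ0 : 0 ≤ ρ x)
    (hmass : divergence (fun y => ρ y • v y) x = 0) :
    γ / (γ - 1) * divergence (fun y => pressure A γ ρ y • v y) x
      = fderiv ℝ (pressure A γ ρ) x (v x) := by
  have hwork := fderiv_pressure_apply_of_mass (A := A) hγ.le (hρ.differentiable one_ne_zero x) hv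
    hρ0 hmass
  have hγ1 : γ - 1 ≠ 0 := by linarith
  rw [divergence_smul ((contDiff_pressure hγ.le hρ).differentiable one_ne_zero x) hv, hwork]
  field_simp
  ring

lemma divergence_norm_sq_smul_of_mass (hρ : DifferentiableAt ℝ ρ x) (hv : DifferentiableAt ℝ v x)
    (hmass : divergence (fun y => ρ y • v y) x = 0) :
    divergence (fun y => ‖v y‖ ^ 2 • ρ y • v y) x = 2 * ⟪v x, ρ x • fderiv ℝ v x (v x)⟫ := by
  rw [divergence_smul (hv.norm_sq ℝ) (hρ.fun_smul hv), hmass, hv.hasFDerivAt.norm_sq.fderiv]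
  simp [inner_smul_right, mul_left_comm]

/-- The flux of the energy balance of a stationary flow: transport of kinetic energy and work of
the pressure and of the viscous stresses. Adding the null form `∇ · ((v · ∇) v - (∇ · v) v)`,
quadratic in the first derivatives of `v`, with weight `μ - c` makes the balance coercive. -/
noncomputable def energyFlux (μ lam A γ c : ℝ) (ρ : 𝔼 d → ℝ) (v : 𝔼 d → 𝔼 d) (x : 𝔼 d) : 𝔼 d :=
  (1 / 2 : ℝ) • ‖v x‖ ^ 2 • ρ x • v x + (γ / (γ - 1)) • pressure A γ ρ x • v x
    - (μ / 2) • ∇ (fun y => ‖v y‖ ^ 2) x - (lam + 2 * μ - c) • divergence v x • v x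
    + (μ - c) • fderiv ℝ v x (v x)

variable {c : ℝ}

lemma contDiff_energyFlux (hγ : 1 ≤ γ) (hρ : ContDiff ℝ 1 ρ) (hv : ContDiff ℝ 2 v) :
    ContDiff ℝ 1 (energyFlux μ lam A γ c ρ v) := by
  have hv1 : ContDiff ℝ 1 v := hv.of_le one_le_two
  have hP : ContDiff ℝ 1 (pressure A γ ρ) := contDiff_pressure hγ hρ
  have hdiv : ContDiff ℝ 1 (divergence v) := contDiff_divergence hv one_add_one_eq_two.le
  have hgrad : ContDiff ℝ 1 (∇ fun y => ‖v y‖ ^ 2) := contDiff_gradient (hv.norm_sq ℝ)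
  have hadv : ContDiff ℝ 1 fun y => fderiv ℝ v y (v y) := (contDiff_one_fderiv hv).clm_apply hv1
  have hnorm : ContDiff ℝ 1 fun y => ‖v y‖ ^ 2 := hv1.norm_sq ℝ
  unfold energyFlux
  fun_prop

lemma norm_energyFlux_le {M : ℝ} (hγ : 0 ≤ γ) (hv : DifferentiableAt ℝ v x)
    (hρ0 : 0 ≤ ρ x) (hρM : ρ x ≤ M) :
    ‖energyFlux μ lam A γ c ρ v x‖ ≤
      (M / 2 + |γ / (γ - 1)| * (|A| * M ^ γ) + |μ| + |lam + 2 * μ - c| * d + |μ - c|)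
        * (‖v x‖ + ‖v x‖ ^ 3 + ‖v x‖ * ‖fderiv ℝ v x‖) := by
  have hM : 0 ≤ M := hρ0.trans hρM
  have hkinetic : ‖(1 / 2 : ℝ) • ‖v x‖ ^ 2 • ρ x • v x‖ ≤ M / 2 * ‖v x‖ ^ 3 := by
    rw [norm_smul, norm_smul, norm_smul, Real.norm_of_nonneg hρ0]
    simp only [Real.norm_eq_abs, abs_pow, abs_norm]
    nlinarith [pow_nonneg (norm_nonneg (v x)) 3]
  have hpressure : ‖(γ / (γ - 1)) • pressure A γ ρ x • v x‖
      ≤ |γ / (γ - 1)| * (|A| * M ^ γ) * ‖v x‖ := by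
    rw [norm_smul, norm_smul, pressure, norm_mul, Real.norm_of_nonneg (Real.rpow_nonneg hρ0 γ),
      ← mul_assoc, Real.norm_eq_abs, Real.norm_eq_abs]
    gcongr
  have hgradient : ‖(μ / 2) • ∇ (fun y => ‖v y‖ ^ 2) x‖ ≤ |μ| * (‖v x‖ * ‖fderiv ℝ v x‖) := by
    rw [norm_smul, norm_div, Real.norm_eq_abs, Real.norm_two, div_mul_eq_mul_div,
      div_le_iff₀ two_pos]
    nlinarith [norm_gradient_norm_sq_le hv, abs_nonneg μ]
  have hdivergence : ‖(lam + 2 * μ - c) • divergence v x • v x‖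
      ≤ |lam + 2 * μ - c| * d * (‖v x‖ * ‖fderiv ℝ v x‖) := by
    rw [norm_smul, norm_smul, Real.norm_eq_abs, Real.norm_eq_abs, mul_assoc, mul_left_comm (d : ℝ),
      mul_comm |divergence v x|]
    gcongr
    exact abs_divergence_le hv
  have hadvection : ‖(μ - c) • fderiv ℝ v x (v x)‖ ≤ |μ - c| * (‖v x‖ * ‖fderiv ℝ v x‖) := by
    rw [norm_smul, Real.norm_eq_abs, mul_comm ‖v x‖]
    gcongr
    exact (fderiv ℝ v x).le_opNorm (v x)
  refine (norm_add_le_of_le (norm_sub_le_of_le (norm_sub_le_of_le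
    (norm_add_le_of_le hkinetic hpressure) hgradient) hdivergence) hadvection).trans ?_
  have hn : 0 ≤ ‖v x‖ := norm_nonneg _
  have hn3 : 0 ≤ ‖v x‖ ^ 3 := by positivity
  have hnq : 0 ≤ ‖v x‖ * ‖fderiv ℝ v x‖ := by positivity
  simp only [add_mul _ _ (‖v x‖ + ‖v x‖ ^ 3 + ‖v x‖ * ‖fderiv ℝ v x‖)]
  gcongr <;> linarith

namespace IsClassicalStationarySolution

lemma smul_fderiv_apply (h : IsClassicalStationarySolution μ lam A γ ρ v) (x : 𝔼 d) :
    ρ x • fderiv ℝ v x (v x) =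
      -∇ (pressure A γ ρ) x + μ • Δ v x + (μ + lam) • ∇ (divergence v) x := by
  have hv := h.contDiff_velocity.differentiable two_ne_zero x
  have hρv := (h.contDiff_density.differentiable one_ne_zero x).fun_smul hv
  ext i
  have hvi := hasFDerivAt_apply hv.hasFDerivAt i
  have hconvect : divergence (fun y => (ρ y * v y i) • v y) x = ρ x * fderiv ℝ v x (v x) i := by
    simp only [mul_comm (ρ _), mul_smul]
    rw [divergence_smul hvi.differentiableAt hρv, h.mass, hvi.fderiv]
    simp [mul_comm]
  simpa [hconvect] using h.momentum x i

lemma divergence_energyFlux (h : IsClassicalStationarySolution μ lam A γ ρ v) (hγ : 1 < γ)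
    (c : ℝ) (x : 𝔼 d) :
    divergence (energyFlux μ lam A γ c ρ v) x =
      -(μ * ∑ i, ‖fderiv ℝ v x (EuclideanSpace.single i 1)‖ ^ 2
        + (lam + 2 * μ - c) * divergence v x ^ 2
        - (μ - c) * ∑ i, fderiv ℝ v x (fderiv ℝ v x (EuclideanSpace.single i 1)) i) := by
  have hv : ContDiff ℝ 2 v := h.contDiff_velocity
  have hv1 := hv.differentiable two_ne_zero x
  have hnorm1 : DifferentiableAt ℝ (fun y => ‖v y‖ ^ 2) x := hv1.norm_sq ℝ
  have hρ1 := h.contDiff_density.differentiable one_ne_zero x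
  have hP1 := (contDiff_pressure (A := A) hγ.le h.contDiff_density).differentiable one_ne_zero x
  have hdiv1 := (contDiff_divergence hv one_add_one_eq_two.le).differentiable one_ne_zero x
  have hgrad1 := (contDiff_gradient (hv.norm_sq ℝ)).differentiable one_ne_zero x
  have hadv1 := ((contDiff_one_fderiv hv).differentiable one_ne_zero x).clm_apply hv1
  have hmomentum : ⟪v x, ρ x • fderiv ℝ v x (v x)⟫ = -fderiv ℝ (pressure A γ ρ) x (v x)
      + μ * ⟪v x, Δ v x⟫ + (μ + lam) * fderiv ℝ (divergence v) x (v x) := by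
    simp [h.smul_fderiv_apply, inner_add_right, inner_smul_right]
  unfold energyFlux
  rw [divergence_add, divergence_sub, divergence_sub, divergence_add, divergence_const_smul,
    divergence_norm_sq_smul_of_mass hρ1 hv1 (h.mass x), hmomentum, divergence_const_smul,
    divergence_pressure_smul_of_mass hγ h.contDiff_density hv1 (h.density_nonneg x) (h.mass x),
    divergence_const_smul, divergence_gradient (hv.norm_sq ℝ),
    laplacian_norm_sq hv (EuclideanSpace.basisFun (Fin d) ℝ), divergence_const_smul,
    divergence_smul hdiv1 hv1, divergence_const_smul, divergence_fderiv_apply hv hv1]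
  · simp only [EuclideanSpace.basisFun_apply]
    ring
  all_goals fun_prop

lemma mul_norm_fderiv_sq_le (h : IsClassicalStationarySolution μ lam A γ ρ v) (hγ : 1 < γ)
    (hc : 0 ≤ c) (hcμ : c ≤ μ) (hclam : c ≤ lam + 2 * μ) (x : 𝔼 d) :
    c * ‖fderiv ℝ v x‖ ^ 2 ≤ -divergence (energyFlux μ lam A γ c ρ v) x := by
  have hnorm : ‖fderiv ℝ v x‖ ^ 2 ≤ ∑ i, ‖fderiv ℝ v x (EuclideanSpace.single i 1)‖ ^ 2 := by
    simpa using norm_sq_le_sum_norm_sq (EuclideanSpace.basisFun (Fin d) ℝ) (fderiv ℝ v x)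
  have hnull := mul_le_mul_of_nonneg_left (sum_apply_apply_le_sum_norm_sq (fderiv ℝ v x))
    (sub_nonneg.2 hcμ)
  have hdiv := mul_nonneg (sub_nonneg.2 hclam) (sq_nonneg (divergence v x))
  rw [h.divergence_energyFlux hγ]
  linarith [mul_le_mul_of_nonneg_left hnorm hc]

lemma fderiv_velocity_eq_zero (h : IsClassicalStationarySolution μ lam A γ ρ v)
    (hμ : 0 < μ) (hlam : 0 < lam + 2 * μ) (hγ : 1 < γ) (hρ : BddAbove (range ρ))
    (hdecay : Tendsto (fun R => R⁻¹ * ∫ x in annulus (𝔼 d) R, (‖v x‖ + ‖v x‖ ^ 3)) atTop (𝓝 0))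
    (x : 𝔼 d) : fderiv ℝ v x = 0 := by
  obtain ⟨M, hM⟩ := hρ
  have hρM (y : 𝔼 d) : ρ y ≤ M := hM (mem_range_self y)
  have hM0 : 0 ≤ M := (h.density_nonneg x).trans (hρM x)
  have hv : ContDiff ℝ 2 v := h.contDiff_velocity
  have hvcont : Continuous v := hv.continuous
  have hc : 0 < min μ (lam + 2 * μ) := lt_min hμ hlam
  refine norm_eq_zero.1 <| eq_zero_of_le_neg_divergence (N := fun y => ‖v y‖) hc ?_
    (contDiff_energyFlux hγ.le h.contDiff_density hv)
    (contDiff_one_fderiv hv).continuous.norm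
    (Continuous.locallyIntegrable (by fun_prop)) (fun y => ?_)
    (fun y => norm_energyFlux_le (by linarith) (hv.differentiable two_ne_zero y)
      (h.density_nonneg y) (hρM y))
    (h.mul_norm_fderiv_sq_le hγ hc.le (min_le_left _ _) (min_le_right _ _)) hdecay x
  · positivity
  · nlinarith [mul_nonneg (norm_nonneg (v y)) (sq_nonneg (‖v y‖ - 1))]

lemma velocity_eq_zero (h : IsClassicalStationarySolution μ lam A γ ρ v)
    (hμ : 0 < μ) (hlam : 0 < lam + 2 * μ) (hγ : 1 < γ) (hρ : BddAbove (range ρ))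
    (hdecay : Tendsto (fun R => R⁻¹ * ∫ x in annulus (𝔼 d) R, (‖v x‖ + ‖v x‖ ^ 3)) atTop (𝓝 0))
    (x : 𝔼 d) : v x = 0 := by
  obtain hsub | hnontrivial := subsingleton_or_nontrivial (𝔼 d)
  · exact Subsingleton.elim _ _
  have hconst (y : 𝔼 d) : v y = v x :=
    is_const_of_fderiv_eq_zero (h.contDiff_velocity.differentiable two_ne_zero)
      (h.fderiv_velocity_eq_zero hμ hlam hγ hρ hdecay) y x
  simp_rw [hconst] at hdecay
  have hzero := eq_zero_of_tendsto_annulus_average hdecay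
  exact norm_eq_zero.1 ((add_eq_zero_iff_of_nonneg (by positivity) (by positivity)).1 hzero).1

lemma exists_density_eq_const (h : IsClassicalStationarySolution μ lam A γ ρ v) (hA : A ≠ 0)
    (hγ : 1 ≤ γ) (hv : ∀ x, v x = 0) : ∃ c, ∀ x, ρ x = c := by
  obtain rfl : v = fun _ => 0 := funext hv
  have hdiff := (contDiff_pressure (A := A) hγ h.contDiff_density).differentiable one_ne_zero
  have hgrad (x : 𝔼 d) : fderiv ℝ (pressure A γ ρ) x = 0 := by
    have hdiv : divergence (fun _ : 𝔼 d => (0 : 𝔼 d)) = fun _ => 0 :=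
      funext fun y => by simp [divergence]
    have hforce : ∇ (pressure A γ ρ) x = 0 := by
      simpa [hdiv, eq_comm] using h.smul_fderiv_apply x
    simpa [gradient] using hforce
  refine ⟨ρ 0, fun x => ?_⟩
  have hP : A * ρ x ^ γ = A * ρ 0 ^ γ := is_const_of_fderiv_eq_zero hdiff hgrad x 0
  exact (Real.rpow_left_inj (h.density_nonneg x) (h.density_nonneg 0) (by linarith)).1
    (mul_left_cancel₀ hA hP)

end IsClassicalStationarySolution

end Solutions

lemma bddAbove_range_of_memLp_top {X : Type*} [TopologicalSpace X] [MeasurableSpace X]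
    {μ : Measure X} [μ.IsOpenPosMeasure] {f : X → ℝ} (hf : Continuous f) (hf_top : MemLp f ⊤ μ) :
    BddAbove (range f) := by
  have hclosed : IsClosed {x | ‖f x‖ ≤ lpNorm f ⊤ μ} := isClosed_le hf.norm continuous_const
  have hdense : Dense {x | ‖f x‖ ≤ lpNorm f ⊤ μ} :=
    Measure.dense_of_ae (ae_le_lpNorm_exponent_top hf_top)
  refine ⟨lpNorm f ⊤ μ, forall_mem_range.2 fun x => (le_abs_self _).trans ?_⟩
  exact hclosed.closure_subset (hdense x)

lemma tendsto_annulus_average_of_memLp {F : Type*} [NormedAddCommGroup F] {d : ℕ} (hd : 2 ≤ d)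
    {v : 𝔼 d → F} (hv₁ : MemLp v (ENNReal.ofReal ((d : ℝ) / ((d : ℝ) - 1))))
    (hv₂ : MemLp v (ENNReal.ofReal (3 * (d : ℝ) / ((d : ℝ) - 1)))) :
    Tendsto (fun R => R⁻¹ * ∫ x in annulus (𝔼 d) R, (‖v x‖ + ‖v x‖ ^ 3)) atTop (𝓝 0) := by
  have hconj : (finrank ℝ (𝔼 d) : ℝ).HolderConjugate ((d : ℝ) / ((d : ℝ) - 1)) := by
    rw [finrank_euclideanSpace_fin]
    exact .conjExponent (by exact_mod_cast hd)
  rw [mul_div_assoc, ENNReal.ofReal_mul three_pos.le, ENNReal.ofReal_ofNat] at hv₂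
  exact tendsto_annulus_average_norm_add_norm_cube hconj hv₁ hv₂

end CompressibleNS

theorem theorem2_general {d : ℕ} {μ lam A γ : ℝ}
    (hμ : 0 < μ) (hlam : 0 < lam + 2 * μ) (hA : A ≠ 0) (hγ : 1 < γ)
    {ρ : EuclideanSpace ℝ (Fin d) → ℝ}
    {v : EuclideanSpace ℝ (Fin d) → EuclideanSpace ℝ (Fin d)}
    (hsol : CompressibleNS.IsClassicalStationarySolution μ lam A γ ρ v)
    (hρ : BddAbove (Set.range ρ))
    (hv : Filter.Tendsto
      (fun R : ℝ => R⁻¹ * ∫ x in CompressibleNS.annulus _ R, (‖v x‖ + ‖v x‖ ^ 3))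
      Filter.atTop (nhds 0)) :
    (∀ x, v x = 0) ∧ ∃ c : ℝ, ∀ x, ρ x = c :=
  have hv0 := hsol.velocity_eq_zero hμ hlam hγ hρ hv
  ⟨hv0, hsol.exists_density_eq_const hA hγ.le hv0⟩

theorem theorem2 (d : ℕ) (hd : 2 ≤ d) (μ lam A γ : ℝ)
    (hμ : 0 < μ) (hlam : 0 < lam + 2 * μ) (hA : 0 < A) (hγ : 1 < γ)
    (ρ : EuclideanSpace ℝ (Fin d) → ℝ)
    (v : EuclideanSpace ℝ (Fin d) → EuclideanSpace ℝ (Fin d))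
    (hsol : CompressibleNS.IsSmoothStationarySolution μ lam A γ ρ v)
    (hρ : MemLp ρ ⊤ volume)
    (hv₁ : MemLp v (ENNReal.ofReal ((d : ℝ) / ((d : ℝ) - 1))) volume)
    (hv₂ : MemLp v (ENNReal.ofReal (3 * (d : ℝ) / ((d : ℝ) - 1))) volume) :
    (∀ x, v x = 0) ∧ ∃ c : ℝ, ∀ x, ρ x = c :=
  theorem2_general hμ hlam hA.ne' hγ hsol.isClassicalStationarySolution
    (CompressibleNS.bddAbove_range_of_memLp_top hsol.smooth_density.continuous hρ)
    (CompressibleNS.tendsto_annulus_average_of_memLp hd hv₁ hv₂)
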